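/- Let $R$ be a finite commutative ring with unity, let $L(R)$ be its set of non-zero zero divisors, and let $\Gamma(R)$ be its zero-divisor graph: the simple graph with vertex set $L(R)$ in which two distinct vertices $x,y$ are adjacent if and only if $xy=0$. Suppose that $|L(R)|\ge 3$, that $\Gamma(R)$ has a cut vertex (a vertex whose removal disconnects the graph), and that $\Gamma(R)$ has no vertex of degree $1$. Then $\mathrm{Dim}_d(\Gamma(R))$ is $3$ or $5$. Here, for a finite graph $G$ with at least two vertices, the dominant metric dimension $\mathrm{Dim}_d(G)$ is the least cardinality of a set $W$ of vertices of $G$ that is resolving (distinct vertices $u\neq v$ of $G$ satisfy $d(u,w)\ne d(v,w)$ for some $w\in W$) and dominating (every vertex of $G$ outside $W$ is adjacent to a vertex in $W$). -/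

import Mathlib

namespace ZeroDivisorGraph

/-- The set `L(R)` of non-zero zero divisors of a commutative ring `R`. -/
def L (R : Type*) [CommRing R] : Set R :=
  {x | x ≠ 0 ∧ ∃ y : R, y ≠ 0 ∧ x * y = 0}

/-- The zero-divisor graph `Γ(R)` (Anderson and Livingston): the vertices are the non-zero zero
divisors of `R`, and two distinct vertices are adjacent iff their product is zero. -/
def Γ (R : Type*) [CommRing R] : SimpleGraph (L R) where
  Adj x y := x ≠ y ∧ (x : R) * (y : R) = 0
  symm := ⟨fun x y h => ⟨h.1.symm, by rw [mul_comm]; exact h.2⟩⟩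
  loopless := ⟨fun _ h => h.1 rfl⟩

variable {V : Type*}

/-- `v` is a cut vertex of `G`: deleting `v` separates two other vertices that are joined by a
walk in `G`. For connected `G` this says that `G - v` has at least two components. -/
def IsCutVertex (G : SimpleGraph V) (v : V) : Prop :=
  ∃ (u w : V) (hu : u ∈ ({v}ᶜ : Set V)) (hw : w ∈ ({v}ᶜ : Set V)),
    G.Reachable u w ∧ ¬ (G.induce ({v}ᶜ : Set V)).Reachable ⟨u, hu⟩ ⟨w, hw⟩

/-- Every vertex outside `S` has a neighbour in `S`. -/
def IsDominating (G : SimpleGraph V) (S : Finset V) : Prop :=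
  ∀ x, x ∉ S → ∃ u ∈ S, G.Adj x u

/-- Vertices with the same distances to all members of `W` are equal. -/
def IsResolving (G : SimpleGraph V) (W : Finset V) : Prop :=
  ∀ u v, (∀ w ∈ W, G.edist u w = G.edist v w) → u = v

/-- The dominant metric dimension: the least cardinality of a set of vertices that is both
resolving and dominating. -/
noncomputable def dominantMetricDim (G : SimpleGraph V) : ℕ :=
  sInf {n | ∃ W : Finset V, W.card = n ∧ IsResolving G W ∧ IsDominating G W}

end ZeroDivisorGraph

namespace ZeroDivisorGraph

/-- Multiplicative data of a finite local ring of order `16` with maximal ideal `Ann a`, spanned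
modulo `{0, a}` by `w` and `z`, where `y`, `x` is dual to `w`, `z` for the product form. -/
structure DualBasis {R : Type*} [CommRing R] (a x y w z : R) : Prop where
  ne_zero : a ≠ 0
  add_self : a + a = 0
  mul_eq_zero : ∀ t ∈ L R, t * a = 0
  x_mul : x * a = 0
  y_mul : y * a = 0
  w_mul : w * a = 0
  z_mul : z * a = 0
  w_mul_x : w * x = 0
  w_mul_y : w * y = a
  z_mul_x : z * x = a
  z_mul_y : z * y = 0
  mul_w : ∀ t, t * a = 0 → t * w = 0 ∨ t * w = a
  mul_z : ∀ t, t * a = 0 → t * z = 0 ∨ t * z = a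
  eq_of_mul : ∀ t, t * w = 0 → t * z = 0 → t = 0 ∨ t = a
  span : ∀ t, t * a = 0 → ∃ s, (s = 0 ∨ s = w ∨ s = z ∨ s = w + z) ∧ (t = s ∨ t = s + a)

section Structure

variable {R : Type*} [CommRing R] {a : R} {P : R → Prop}

lemma mul_eq_zero_or_eq
    (hP : ∀ p q : R, p ≠ 0 → p ≠ a → q ≠ 0 → q ≠ a → p * q = 0 → (P p ↔ P q))
    {x y : R} (hx0 : x ≠ 0) (hxa : x ≠ a) (hx : P x) (hy0 : y ≠ 0) (hya : y ≠ a) (hy : ¬ P y)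
    (hax : x * a = 0) (hay : y * a = 0) (r : R) : r * a = 0 ∨ r * a = a := by
  by_contra! h
  have h1 := hP (r * a) x h.1 h.2 hx0 hxa (by linear_combination r * hax)
  have h2 := hP (r * a) y h.1 h.2 hy0 hya (by linear_combination r * hay)
  tauto

lemma mul_self_eq_zero_of_separating (hRa : ∀ r : R, r * a = 0 ∨ r * a = a)
    (ha1 : a ≠ 1)
    (hn : ∀ u : R, u ≠ 0 → u ≠ a → u * a = 0 → ∃ v, v ≠ 0 ∧ v ≠ a ∧ v ≠ u ∧ u * v = 0) :
    a * a = 0 := by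
  by_contra h
  have haa : a * a = a := (hRa a).resolve_left h
  obtain ⟨v, hv0, hva, -, hv⟩ := hn (1 - a) (fun h1 => ha1 (sub_eq_zero.1 h1).symm)
    (fun h1 => h (by linear_combination (-a) * h1 - haa)) (by linear_combination -haa)
  have hv' : v * a = v := by linear_combination -hv
  rcases hRa v with h1 | h1
  · exact hv0 (hv' ▸ h1)
  · exact hva (hv' ▸ h1)

lemma exists_isIdempotentElem_pow [Finite R] (z : R) : ∃ n : ℕ, 0 < n ∧ IsIdempotentElem (z ^ n) := by
  obtain ⟨m, n, hmn, h⟩ := Finite.exists_ne_map_eq_of_infinite (fun k : ℕ => z ^ k)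
  wlog hlt : m < n generalizing m n
  · exact this n m hmn.symm h.symm (by omega)
  obtain ⟨d, rfl⟩ := Nat.exists_eq_add_of_lt hlt
  have h1 : ∀ j k, z ^ (m + j + k * (d + 1)) = z ^ (m + j) := by
    intro j k
    induction k with
    | zero => simp
    | succ k ih =>
      rw [← ih]
      calc z ^ (m + j + (k + 1) * (d + 1)) = z ^ (m + d + 1) * z ^ (j + k * (d + 1)) := by ring
        _ = z ^ (m + j + k * (d + 1)) := by rw [← h]; ring
  refine ⟨(m + 1) * (d + 1), by positivity, ?_⟩
  have h2 := h1 (m * d + d + 1) (m + 1)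
  have h3 : m + (m * d + d + 1) = (m + 1) * (d + 1) := by ring
  rw [h3] at h2
  rw [IsIdempotentElem, ← pow_add, h2]

lemma mul_eq_zero_of_mem_L [Finite R] (ha0 : a ≠ 0)
    (hP : ∀ p q : R, p ≠ 0 → p ≠ a → q ≠ 0 → q ≠ a → p * q = 0 → (P p ↔ P q))
    {x y : R} (hx : x ∈ L R) (hxa : x ≠ a) (hxP : P x) (hy : y ∈ L R) (hya : y ≠ a) (hyP : ¬ P y)
    (hRa : ∀ r : R, r * a = 0 ∨ r * a = a) (haa : a * a = 0)
    (hn : ∀ u ∈ L R, u ≠ a → ∃ v, v ≠ 0 ∧ v ≠ a ∧ v ≠ u ∧ u * v = 0)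
    (t : R) (ht : t ∈ L R) : t * a = 0 := by
  by_contra hta
  replace hta : t * a = a := (hRa t).resolve_left hta
  obtain ⟨n, hn0, he⟩ := exists_isIdempotentElem_pow t
  have hpow : ∀ k : ℕ, t ^ k * a = a := by
    intro k
    induction k with
    | zero => simp
    | succ k ih => rw [pow_succ, mul_assoc, hta, ih]
  obtain ⟨-, s, hs0, hs⟩ := ht
  have hes : t ^ n * s = 0 := by
    obtain ⟨k, rfl⟩ := Nat.exists_eq_succ_of_ne_zero hn0.ne'
    rw [pow_succ, mul_assoc, hs, mul_zero]
  have hea := hpow n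
  generalize t ^ n = e at he hes hea
  obtain ⟨f, hf⟩ : ∃ f, f = 1 - e := ⟨_, rfl⟩
  have hff : f * f = f := by rw [hf]; linear_combination he.eq
  have hfa : f * a = 0 := by rw [hf]; linear_combination -hea
  have hf0 : f ≠ 0 := by
    rintro h
    exact hs0 (by rw [hf] at h; linear_combination hes + s * h)
  have hfna : f ≠ a := by
    rintro h
    rw [h, haa] at hff
    exact ha0 hff.symm
  have hafa : a + f ≠ a := by simpa using hf0
  have haf0 : a + f ≠ 0 := by
    intro h
    exact hf0 (by linear_combination f * h - hff - hfa)
  obtain ⟨b, hb0, hba, -, hb⟩ := hn (a + f) ⟨haf0, a, ha0, by linear_combination haa + hfa⟩ hafa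
  have hbf : b * f = 0 := by linear_combination f * hb - b * hfa - b * hff
  have key : ∀ u ∈ L R, u ≠ a → (P u ↔ P f) := by
    intro u hu hua
    by_cases huf : u * f = 0
    · exact hP u f hu.1 hua hf0 hfna huf
    obtain ⟨v, hv0, hva, -, huv⟩ := hn u hu hua
    by_cases hvf : v * f = 0
    · exact (hP u v hu.1 hua hv0 hva huv).trans (hP v f hv0 hva hf0 hfna hvf)
    have hvfa : v * f ≠ a := by
      intro h
      exact hvf (by linear_combination f * h + hfa - v * hff)
    exact (hP u (v * f) hu.1 hua hvf hvfa (by linear_combination f * huv)).trans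
      ((hP (v * f) b hvf hvfa hb0 hba (by linear_combination v * hbf)).trans
        (hP b f hb0 hba hf0 hfna hbf))
  exact hyP ((key y hy hya).2 ((key x hx hxa).1 hxP))

lemma mul_eq_of_separated
    (hP : ∀ p q : R, p ≠ 0 → p ≠ a → q ≠ 0 → q ≠ a → p * q = 0 → (P p ↔ P q))
    (hn : ∀ u ∈ L R, u ≠ a → ∃ v, v ≠ 0 ∧ v ≠ a ∧ v ≠ u ∧ u * v = 0)
    {x y : R} (hx : x ∈ L R) (hxa : x ≠ a) (hy : y ∈ L R) (hya : y ≠ a) (hxy : ¬ (P x ↔ P y)) :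
    x * y = a := by
  obtain ⟨w, hw0, hwa, -, hw⟩ := hn x hx hxa
  obtain ⟨z, hz0, hza, -, hz⟩ := hn y hy hya
  have h1 := hP x w hx.1 hxa hw0 hwa hw
  have h2 := hP y z hy.1 hya hz0 hza hz
  by_contra h
  have h0 : x * y ≠ 0 := fun h0 => hxy (hP x y hx.1 hxa hy.1 hya h0)
  have h3 := hP (x * y) w h0 h hw0 hwa (by linear_combination y * hw)
  have h4 := hP (x * y) z h0 h hz0 hza (by linear_combination x * hz)
  tauto

lemma mul_eq_zero_or_eq_of_separated (ha0 : a ≠ 0)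
    (hP : ∀ p q : R, p ≠ 0 → p ≠ a → q ≠ 0 → q ≠ a → p * q = 0 → (P p ↔ P q))
    (hn : ∀ u ∈ L R, u ≠ a → ∃ v, v ≠ 0 ∧ v ≠ a ∧ v ≠ u ∧ u * v = 0)
    {x y : R} (hx : x ∈ L R) (hxa : x ≠ a) (hy : y ∈ L R) (hya : y ≠ a) (hxy : ¬ (P x ↔ P y))
    (t : R) (ht : t * a = 0) : t * x = 0 ∨ t * x = a := by
  obtain ⟨w, hw0, hwa, -, hw⟩ := hn x hx hxa
  have h1 := hP x w hx.1 hxa hw0 hwa hw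
  by_contra! h
  have h0 : t * x * w = 0 := by linear_combination t * hw
  have h2 := hP (t * x) w h.1 h.2 hw0 hwa h0
  have h3 := mul_eq_of_separated hP hn hx hxa hy hya hxy
  have h4 := mul_eq_of_separated hP hn ⟨h.1, w, hw0, h0⟩ h.2 hy hya (by tauto)
  exact ha0 (by linear_combination t * h3 + ht - h4)

lemma exists_dualBasis [Finite R] (ha0 : a ≠ 0)
    (hP : ∀ p q : R, p ≠ 0 → p ≠ a → q ≠ 0 → q ≠ a → p * q = 0 → (P p ↔ P q))
    {x y : R} (hx0 : x ≠ 0) (hxa : x ≠ a) (hx : P x) (hy0 : y ≠ 0) (hya : y ≠ a) (hy : ¬ P y)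
    (hax : x * a = 0) (hay : y * a = 0)
    (hn : ∀ u : R, (∃ v, v ≠ 0 ∧ v ≠ u ∧ u * v = 0) → u ≠ 0 → u ≠ a →
      ∃ v, v ≠ 0 ∧ v ≠ a ∧ v ≠ u ∧ u * v = 0) :
    ∃ w z, DualBasis a x y w z := by
  have hRa := mul_eq_zero_or_eq hP hx0 hxa hx hy0 hya hy hax hay
  have ha1 : a ≠ 1 := by rintro rfl; exact hx0 (by simpa using hax)
  have haa := mul_self_eq_zero_of_separating hRa ha1
    fun u hu0 hua hu => hn u ⟨a, ha0, hua.symm, hu⟩ hu0 hua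
  have hn' : ∀ u ∈ L R, u ≠ a → ∃ v, v ≠ 0 ∧ v ≠ a ∧ v ≠ u ∧ u * v = 0 := by
    rintro u ⟨hu0, v, hv0, huv⟩ hua
    refine hn u ?_ hu0 hua
    rcases hRa u with h | h
    · exact ⟨a, ha0, hua.symm, h⟩
    · refine ⟨v, hv0, ?_, huv⟩
      rintro rfl
      exact ha0 (by linear_combination (-v - 1) * h + a * huv)
  have hxL : x ∈ L R := ⟨hx0, a, ha0, hax⟩
  have hyL : y ∈ L R := ⟨hy0, a, ha0, hay⟩
  have hL := mul_eq_zero_of_mem_L ha0 hP hxL hxa hx hyL hya hy hRa haa hn'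
  have h2a : a + a = 0 := by
    rcases hRa 2 with h | h
    · linear_combination h
    · exact absurd (by linear_combination h) ha0
  have hkill : ∀ {x y : R}, x ∈ L R → x ≠ a → y ∈ L R → y ≠ a → ¬ (P x ↔ P y) → ∀ t,
      t * x = 0 → t * y = 0 → t = 0 ∨ t = a := by
    intro x y hx hxa hy hya hxy t htx hty
    by_contra! h
    have h1 := hP t x h.1 h.2 hx.1 hxa htx
    have h2 := hP t y h.1 h.2 hy.1 hya hty
    tauto
  obtain ⟨w, hw0, hwa, -, hxw⟩ := hn' x hxL hxa
  obtain ⟨z, hz0, hza, -, hyz⟩ := hn' y hyL hya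
  have hw : w ∈ L R := ⟨hw0, x, hx0, by rw [mul_comm, hxw]⟩
  have hz : z ∈ L R := ⟨hz0, y, hy0, by rw [mul_comm, hyz]⟩
  have hPw := hP x w hx0 hxa hw0 hwa hxw
  have hPz := hP y z hy0 hya hz0 hza hyz
  have hwy : w * y = a := mul_eq_of_separated hP hn' hw hwa hyL hya (by tauto)
  have hzx : z * x = a := mul_eq_of_separated hP hn' hz hza hxL hxa (by tauto)
  refine ⟨w, z, ⟨ha0, h2a, hL, hax, hay, hL w hw, hL z hz, by rw [mul_comm, hxw], hwy, hzx,
    by rw [mul_comm, hyz],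
    mul_eq_zero_or_eq_of_separated ha0 hP hn' hw hwa hz hza (by tauto),
    mul_eq_zero_or_eq_of_separated ha0 hP hn' hz hza hw hwa (by tauto),
    hkill hw hwa hz hza (by tauto), ?_⟩⟩
  intro t ht
  have hspan : ∀ s, (t - s) * x = 0 → (t - s) * y = 0 → t = s ∨ t = s + a := by
    intro s h1 h2
    rcases hkill hxL hxa hyL hya (by tauto) _ h1 h2 with h | h
    · exact .inl (by linear_combination h)
    · exact .inr (by linear_combination h)
  rcases mul_eq_zero_or_eq_of_separated ha0 hP hn' hxL hxa hyL hya (by tauto) t ht with h1 | h1 <;>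
  rcases mul_eq_zero_or_eq_of_separated ha0 hP hn' hyL hya hxL hxa (by tauto) t ht with h2 | h2
  · exact ⟨0, by simp, hspan 0 (by simpa) (by simpa)⟩
  · exact ⟨w, by simp, hspan w (by linear_combination h1 - hxw) (by linear_combination h2 - hwy)⟩
  · exact ⟨z, by simp, hspan z (by linear_combination h1 - hzx) (by linear_combination h2 - hyz)⟩
  · exact ⟨w + z, by simp, hspan (w + z) (by linear_combination h1 - hxw - hzx)
      (by linear_combination h2 - hwy - hyz)⟩

end Structure

section Graph

variable {R : Type*} [CommRing R]

/-- A cut vertex splits the other vertices into two parts without edges between them, each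
containing a neighbour of the cut vertex. -/
lemma IsCutVertex.exists_separation {V : Type*} {G : SimpleGraph V} {v : V}
    (h : IsCutVertex G v) : ∃ (P : V → Prop) (x y : V),
      (∀ p q, p ≠ v → q ≠ v → G.Adj p q → (P p ↔ P q)) ∧
      P x ∧ G.Adj x v ∧ ¬ P y ∧ G.Adj y v := by
  obtain ⟨u, w, hu, hw, huw, hnot⟩ := h
  let P : V → Prop := fun p =>
    ∃ hp : p ∈ ({v}ᶜ : Set V), (G.induce ({v}ᶜ : Set V)).Reachable ⟨u, hu⟩ ⟨p, hp⟩
  have hstep : ∀ p q, q ≠ v → G.Adj p q → P p → P q := by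
    rintro p q hq hpq ⟨hp, hr⟩
    refine ⟨hq, hr.trans (SimpleGraph.Adj.reachable ?_)⟩
    simpa using hpq
  have hPu : P u := ⟨hu, .refl _⟩
  have hPw : ¬ P w := fun ⟨_, h⟩ => hnot h
  have hclosed : ∀ (Q : V → Prop) {p q : V}, (∀ p q, G.Adj p q → Q p → Q q) → G.Reachable p q →
      Q p → Q q := by
    rintro Q p q hQ ⟨wk⟩
    induction wk with
    | nil => exact id
    | cons hadj _ ih => exact fun hp => ih (hQ _ _ hadj hp)
  have hx : ∃ x, P x ∧ G.Adj x v := by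
    by_contra! hx
    refine hPw (hclosed P (fun p q hpq hp => hstep p q ?_ hpq hp) huw hPu)
    rintro rfl
    exact hx p hp hpq
  have hy : ∃ y, (¬ P y ∧ y ≠ v) ∧ G.Adj y v := by
    by_contra! hy
    refine (hclosed (fun p => ¬ P p ∧ p ≠ v) (fun p q hpq hp => ?_) huw.symm ⟨hPw, hw⟩).1 hPu
    refine ⟨fun hq => hp.1 (hstep q p hp.2 hpq.symm hq), ?_⟩
    rintro rfl
    exact hy p hp hpq
  obtain ⟨x, hx1, hx2⟩ := hx
  obtain ⟨y, hy1, hy2⟩ := hy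
  exact ⟨P, x, y, fun p q hp hq hpq => ⟨hstep p q hq hpq, hstep q p hp hpq.symm⟩,
    hx1, hx2, hy1.1, hy2⟩

lemma exists_dualBasis_of_isCutVertex [Finite R] {v : L R} (hv : IsCutVertex (Γ R) v)
    (hdeg : ∀ v, ((Γ R).neighborSet v).ncard ≠ 1) :
    ∃ a x y w z : R, DualBasis a x y w z := by
  obtain ⟨P, x, y, hP, hPx, hx, hPy, hy⟩ := hv.exists_separation
  refine ⟨v, x, y, exists_dualBasis (P := fun r => ∃ h : r ∈ L R, P ⟨r, h⟩) v.2.1 ?_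
    x.2.1 (fun h => hx.1 (Subtype.ext h)) ⟨x.2, hPx⟩ y.2.1 (fun h => hy.1 (Subtype.ext h))
    (fun ⟨_, h⟩ => hPy h) hx.2 hy.2 ?_⟩
  · intro p q hp0 hp hq0 hq hpq
    have hpL : p ∈ L R := ⟨hp0, q, hq0, hpq⟩
    have hqL : q ∈ L R := ⟨hq0, p, hp0, by rw [mul_comm, hpq]⟩
    by_cases h : p = q
    · rw [h]
    have := hP ⟨p, hpL⟩ ⟨q, hqL⟩ (fun h => hp (congrArg Subtype.val h))
      (fun h => hq (congrArg Subtype.val h)) ⟨fun h' => h (congrArg Subtype.val h'), hpq⟩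
    exact ⟨fun ⟨_, h⟩ => ⟨hqL, this.1 h⟩, fun ⟨_, h⟩ => ⟨hpL, this.2 h⟩⟩
  · rintro u ⟨t, ht0, htu, hut⟩ hu0 -
    by_contra! hno
    have huL : u ∈ L R := ⟨hu0, t, ht0, hut⟩
    have htL : t ∈ L R := ⟨ht0, u, hu0, by rw [mul_comm, hut]⟩
    refine hdeg ⟨u, huL⟩ (Set.ncard_eq_one.2 ⟨v, ?_⟩)
    have hall : ∀ s : L R, (Γ R).Adj ⟨u, huL⟩ s → s = v := by
      intro s hs
      by_contra hsv
      exact hno s s.2.1 (fun h => hsv (Subtype.ext h)) (fun h => hs.1 (Subtype.ext h.symm)) hs.2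
    ext s
    constructor
    · exact hall s
    · rintro rfl
      have hadj : (Γ R).Adj ⟨u, huL⟩ ⟨t, htL⟩ :=
        ⟨fun h => htu (congrArg Subtype.val h).symm, hut⟩
      rw [← hall _ hadj]
      exact hadj

lemma edist_eq_one {p q : L R} (hpq : p ≠ q) (h : (p : R) * q = 0) : (Γ R).edist p q = 1 :=
  SimpleGraph.edist_eq_one_iff_adj.2 ⟨hpq, h⟩

/-- If some vertex annihilates every vertex, distinct non-adjacent vertices have distance `2`. -/
lemma edist_eq_two {a : R} (ha0 : a ≠ 0) (ha : ∀ t ∈ L R, t * a = 0) {p q : L R} (hpq : p ≠ q)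
    (h : (p : R) * q ≠ 0) : (Γ R).edist p q = 2 := by
  have haL : a ∈ L R := ⟨ha0, p, p.2.1, by rw [mul_comm, ha p p.2]⟩
  have hpa : (Γ R).Adj p ⟨a, haL⟩ := by
    refine ⟨?_, ha p p.2⟩
    rintro rfl
    exact h (by rw [mul_comm]; exact ha q q.2)
  have haq : (Γ R).Adj ⟨a, haL⟩ q := by
    refine ⟨?_, by rw [mul_comm]; exact ha q q.2⟩
    rintro rfl
    exact h (ha p p.2)
  apply le_antisymm
  · simpa using SimpleGraph.edist_le (.cons hpa (.cons haq .nil))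
  · have h0 : (Γ R).edist p q ≠ 0 := by simpa using hpq
    have h1 : (Γ R).edist p q ≠ 1 := fun h1 => h (SimpleGraph.edist_eq_one_iff_adj.1 h1).2
    generalize (Γ R).edist p q = d at h0 h1
    induction d using ENat.recTopCoe with
    | top => exact le_top
    | coe d =>
      norm_cast at h0 h1 ⊢
      omega

lemma edist_congr {a : R} (ha0 : a ≠ 0) (ha : ∀ t ∈ L R, t * a = 0) {p q s : L R}
    (hps : p ≠ s) (hqs : q ≠ s) :
    (Γ R).edist p s = (Γ R).edist q s ↔ ((p : R) * s = 0 ↔ (q : R) * s = 0) := by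
  by_cases h1 : (p : R) * s = 0 <;> by_cases h2 : (q : R) * s = 0
  · simp [edist_eq_one hps h1, edist_eq_one hqs h2, h1, h2]
  · simp [edist_eq_one hps h1, edist_eq_two ha0 ha hqs h2, h1, h2]
  · simp [edist_eq_two ha0 ha hps h1, edist_eq_one hqs h2, h1, h2]
  · simp [edist_eq_two ha0 ha hps h1, edist_eq_two ha0 ha hqs h2, h1, h2]

namespace DualBasis

variable {a x y w z : R}

lemma w_ne_zero (h : DualBasis a x y w z) : w ≠ 0 := by
  intro h0
  exact h.ne_zero (by linear_combination y * h0 - h.w_mul_y)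

lemma z_ne_zero (h : DualBasis a x y w z) : z ≠ 0 := by
  intro h0
  exact h.ne_zero (by linear_combination x * h0 - h.z_mul_x)

lemma add_ne_zero (h : DualBasis a x y w z) : w + z ≠ 0 := by
  intro h0
  exact h.ne_zero (by linear_combination y * h0 - h.w_mul_y - h.z_mul_y)

lemma add_mul (h : DualBasis a x y w z) : (w + z) * a = 0 := by
  linear_combination h.w_mul + h.z_mul

lemma mem_L (h : DualBasis a x y w z) {t : R} (ht0 : t ≠ 0) (ht : t * a = 0) : t ∈ L R :=
  ⟨ht0, a, h.ne_zero, ht⟩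

/-- The vertices `w`, `z` and `w + z`. -/
noncomputable def basisSet [DecidableEq (L R)] (h : DualBasis a x y w z) : Finset (L R) :=
  {⟨w, h.mem_L h.w_ne_zero h.w_mul⟩, ⟨z, h.mem_L h.z_ne_zero h.z_mul⟩,
    ⟨w + z, h.mem_L h.add_ne_zero h.add_mul⟩}

lemma mem_basisSet [DecidableEq (L R)] (h : DualBasis a x y w z) (t : L R) :
    t ∈ h.basisSet ↔ (t : R) = w ∨ (t : R) = z ∨ (t : R) = w + z := by
  simp [basisSet, Subtype.ext_iff]

lemma isDominating_basisSet [DecidableEq (L R)] (h : DualBasis a x y w z) :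
    IsDominating (Γ R) h.basisSet := by
  intro t ht
  have hta := h.mul_eq_zero t t.2
  suffices ∃ s : L R, s ∈ h.basisSet ∧ (t : R) * s = 0 by
    obtain ⟨s, hs, hts⟩ := this
    exact ⟨s, hs, fun hst => ht (hst ▸ hs), hts⟩
  rcases h.mul_w t hta with hw | hw
  · exact ⟨⟨w, h.mem_L h.w_ne_zero h.w_mul⟩, by simp [mem_basisSet], hw⟩
  rcases h.mul_z t hta with hz | hz
  · exact ⟨⟨z, h.mem_L h.z_ne_zero h.z_mul⟩, by simp [mem_basisSet], hz⟩
  · exact ⟨⟨w + z, h.mem_L h.add_ne_zero h.add_mul⟩, by simp [mem_basisSet],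
      by linear_combination hw + hz + h.add_self⟩

lemma exists_mem_basisSet_eq_add [DecidableEq (L R)] (h : DualBasis a x y w z) {t : L R}
    (ht : t ∉ h.basisSet) : (t : R) = a ∨ ∃ s ∈ h.basisSet, (t : R) = s + a := by
  rw [mem_basisSet] at ht
  obtain ⟨s, hs, hts⟩ := h.span t (h.mul_eq_zero t t.2)
  rcases hs with rfl | hs
  · exact .inl (by simpa [t.2.1] using hts)
  · have hts : (t : R) = s + a := hts.resolve_left (by rintro rfl; exact ht hs)
    right
    rcases hs with rfl | rfl | rfl
    · exact ⟨⟨_, h.mem_L h.w_ne_zero h.w_mul⟩, by simp [mem_basisSet], hts⟩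
    · exact ⟨⟨_, h.mem_L h.z_ne_zero h.z_mul⟩, by simp [mem_basisSet], hts⟩
    · exact ⟨⟨_, h.mem_L h.add_ne_zero h.add_mul⟩, by simp [mem_basisSet], hts⟩

lemma isResolving_basisSet [DecidableEq (L R)] (h : DualBasis a x y w z) :
    IsResolving (Γ R) h.basisSet := by
  intro u v huv
  by_cases hu : u ∈ h.basisSet
  · have := huv u hu
    rw [SimpleGraph.edist_self, eq_comm, SimpleGraph.edist_eq_zero_iff] at this
    exact this.symm
  by_cases hv : v ∈ h.basisSet
  · have := huv v hv
    rwa [SimpleGraph.edist_self, SimpleGraph.edist_eq_zero_iff] at this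
  have hiff : ∀ s ∈ h.basisSet, ((u : R) * s = 0 ↔ (v : R) * s = 0) := fun s hs =>
    (edist_congr h.ne_zero h.mul_eq_zero (ne_of_mem_of_not_mem hs hu).symm
      (ne_of_mem_of_not_mem hs hv).symm).1
      (huv s hs)
  have hua := h.mul_eq_zero u u.2
  have hva := h.mul_eq_zero v v.2
  have hw : (u : R) * w = v * w := by
    have := hiff ⟨w, h.mem_L h.w_ne_zero h.w_mul⟩ (by simp [mem_basisSet])
    have h0 := h.ne_zero
    rcases h.mul_w u hua with h1 | h1 <;> rcases h.mul_w v hva with h2 | h2 <;> simp_all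
  have hz : (u : R) * z = v * z := by
    have := hiff ⟨z, h.mem_L h.z_ne_zero h.z_mul⟩ (by simp [mem_basisSet])
    have h0 := h.ne_zero
    rcases h.mul_z u hua with h1 | h1 <;> rcases h.mul_z v hva with h2 | h2 <;> simp_all
  apply Subtype.ext
  rcases h.eq_of_mul (u - v) (by linear_combination hw) (by linear_combination hz) with h1 | h1
  · exact sub_eq_zero.1 h1
  exfalso
  rcases h.exists_mem_basisSet_eq_add hu with h2 | ⟨s, hs, h2⟩
  · exact v.2.1 (by linear_combination h2 - h1)
  · refine hv ?_
    convert hs using 1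
    exact Subtype.ext (by linear_combination h2 - h1)

lemma card_basisSet_le [DecidableEq (L R)] (h : DualBasis a x y w z) : h.basisSet.card ≤ 3 :=
  Finset.card_le_three

/-- A vertex `p ≠ a` and its twin `p + a` have the same distances to all other vertices. -/
lemma exists_mem_of_isResolving (h : DualBasis a x y w z) {W : Finset (L R)}
    (hW : IsResolving (Γ R) W) {p : R} (hp0 : p ≠ 0) (hpa : p ≠ a) (hp : p * a = 0) :
    ∃ t ∈ W, (t : R) = p ∨ (t : R) = p + a := by
  by_contra! hno
  have haa : a * a = 0 := h.mul_eq_zero a ⟨h.ne_zero, p, hp0, by rw [mul_comm, hp]⟩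
  have hq0 : p + a ≠ 0 := fun h0 => hpa (by linear_combination h0 - h.add_self)
  have := hW ⟨p, h.mem_L hp0 hp⟩ ⟨p + a, h.mem_L hq0 (by linear_combination hp + haa)⟩ ?_
  · exact h.ne_zero (by simpa using this)
  intro s hs
  have hsa := h.mul_eq_zero s s.2
  rw [edist_congr h.ne_zero h.mul_eq_zero (fun e => (hno s hs).1 (congrArg Subtype.val e).symm)
    (fun e => (hno s hs).2 (congrArg Subtype.val e).symm)]
  have : (p + a) * (s : R) = p * s := by linear_combination hsa
  simp [this]

lemma three_le_card_of_isResolving (h : DualBasis a x y w z) {W : Finset (L R)}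
    (hW : IsResolving (Γ R) W) : 3 ≤ W.card := by
  classical
  have h0 := h.ne_zero
  have hx := h.x_mul
  have hy := h.y_mul
  have hwx := h.w_mul_x
  have hwy := h.w_mul_y
  have hzx := h.z_mul_x
  have hzy := h.z_mul_y
  obtain ⟨t₁, ht₁, e₁⟩ := h.exists_mem_of_isResolving hW h.w_ne_zero
    (fun e => h0 (by linear_combination hy - hwy + y * e)) h.w_mul
  obtain ⟨t₂, ht₂, e₂⟩ := h.exists_mem_of_isResolving hW h.z_ne_zero
    (fun e => h0 (by linear_combination hx - hzx + x * e)) h.z_mul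
  obtain ⟨t₃, ht₃, e₃⟩ := h.exists_mem_of_isResolving hW h.add_ne_zero
    (fun e => h0 (by linear_combination hx - hzx - hwx + x * e)) h.add_mul
  have h1x : (t₁ : R) * x = 0 := by
    rcases e₁ with e | e <;> rw [e]
    · exact hwx
    · linear_combination hwx + hx
  have h2x : (t₂ : R) * x = a := by
    rcases e₂ with e | e <;> rw [e]
    · exact hzx
    · linear_combination hzx + hx
  have h2y : (t₂ : R) * y = 0 := by
    rcases e₂ with e | e <;> rw [e]
    · exact hzy
    · linear_combination hzy + hy
  have h3x : (t₃ : R) * x = a := by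
    rcases e₃ with e | e <;> rw [e]
    · linear_combination hwx + hzx
    · linear_combination hwx + hzx + hx
  have h3y : (t₃ : R) * y = a := by
    rcases e₃ with e | e <;> rw [e]
    · linear_combination hwy + hzy
    · linear_combination hwy + hzy + hy
  rw [← Finset.card_eq_three.2 ⟨t₁, t₂, t₃, ?_, ?_, ?_, rfl⟩]
  · refine Finset.card_le_card ?_
    simp [Finset.insert_subset_iff, ht₁, ht₂, ht₃]
  · rintro rfl
    exact h0 (h2x.symm.trans h1x)
  · rintro rfl
    exact h0 (h3x.symm.trans h1x)
  · rintro rfl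
    exact h0 (h3y.symm.trans h2y)

lemma dominantMetricDim_eq (h : DualBasis a x y w z) : dominantMetricDim (Γ R) = 3 := by
  classical
  have hcard : h.basisSet.card = 3 :=
    h.card_basisSet_le.antisymm (h.three_le_card_of_isResolving h.isResolving_basisSet)
  have hmem : 3 ∈ {n | ∃ W : Finset (L R), W.card = n ∧ IsResolving (Γ R) W ∧
      IsDominating (Γ R) W} :=
    ⟨h.basisSet, hcard, h.isResolving_basisSet, h.isDominating_basisSet⟩
  refine (Nat.sInf_le hmem).antisymm (le_csInf ⟨3, hmem⟩ ?_)
  rintro n ⟨W, rfl, hW, -⟩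
  exact h.three_le_card_of_isResolving hW

end DualBasis

end Graph

end ZeroDivisorGraph

theorem theorem2p3 (R : Type*) [CommRing R] [Finite R]
    (hL : 3 ≤ (ZeroDivisorGraph.L R).ncard)
    (hcut : ∃ v, ZeroDivisorGraph.IsCutVertex (ZeroDivisorGraph.Γ R) v)
    (hdeg : ∀ v, ((ZeroDivisorGraph.Γ R).neighborSet v).ncard ≠ 1) :
    ZeroDivisorGraph.dominantMetricDim (ZeroDivisorGraph.Γ R) = 3 ∨
      ZeroDivisorGraph.dominantMetricDim (ZeroDivisorGraph.Γ R) = 5 := by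
  obtain ⟨v, hv⟩ := hcut
  obtain ⟨a, x, y, w, z, h⟩ := ZeroDivisorGraph.exists_dualBasis_of_isCutVertex hv hdeg
  exact .inl h.dominantMetricDim_eq
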